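/- For $\tau$ in the upper half-plane $\mathbb{H}$ let $\eta(\tau)=e^{\pi i\tau/12}\prod_{n\ge1}(1-e^{2\pi i n\tau})$ and $g_2(\tau)=\left(\eta(2\tau)/\eta(\tau)\right)^{24}$. Let $G_2(q)$, $|q|<1$, be $g_2$ regarded as a function of $q=e^{2\pi i\tau}$, extended to $q=0$ by its limit. For a power series $f=\sum_{n\ge0}a(n)q^n$ put $f|U_2=\sum_{n\ge0}a(2n)q^n$. Then $G_2$ is well defined, i.e. $G_2(e^{2\pi i\tau})=g_2(\tau)$ for all $\tau\in\mathbb{H}$; it is the sum of its Taylor series at $0$ (the $q$-expansion of $g_2$) on the whole disc $|q|<1$; for all complex $q$ with $|q|<1$, $$G_2(q)^2=G_2(q^2)+G_2(q)\left(48\,G_2(q^2)+4096\,G_2(q^2)^2\right);$$ and, as an identity of power series in $q$, $$G_2|U_2=24\,G_2+2048\,G_2^2 .$$ -/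

import Mathlib

open scoped UpperHalfPlane ModularForm

/-- The eta quotient `g₂(τ) = (η(2τ) / η(τ))²⁴` on the upper half-plane. -/
noncomputable def g2 (τ : ℍ) : ℂ :=
  (ModularForm.eta (2 * (τ : ℂ)) / ModularForm.eta (τ : ℂ)) ^ 24

/-- `g₂` as a function `G₂(q)` of the nome `q = e^{2πiτ}`, extended to `q = 0` by its limit. -/
noncomputable def G2 : ℂ → ℂ := UpperHalfPlane.cuspFunction 1 g2

/-- The `q`-expansion of `g₂`, i.e. the Taylor series of `G₂` at `q = 0`. -/
noncomputable def G2Series : PowerSeries ℂ := UpperHalfPlane.qExpansion 1 g2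

/-- The Atkin operator `U_p`: it sends `∑ a(n) qⁿ` to `∑ a(p n) qⁿ`. -/
noncomputable def atkinU {R : Type*} [Semiring R] (p : ℕ) (f : PowerSeries R) : PowerSeries R :=
  PowerSeries.mk fun n => PowerSeries.coeff (p * n) f

open Complex Filter Topology Function Metric

/-! Splitting Euler's product by parity gives `G2 q * G2 (-q) = -G2 (q ^ 2)` (`G2_mul_neg`). So the
quadratic relation says that `G2 q` and `G2 (-q)` are the roots of a quadratic over functions of `q
^ 2`, and only their sum is missing. By the product formula, `weberSum` is that sum divided by `G2
(q ^ 2)`, minus `4096 * G2 (q ^ 2)`. With `q = e^{πiτ}`, `weberSum` is even, hence invariant under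
`T`, and by `G2_fricke` it is invariant under `S`. It is holomorphic on the upper half-plane and
tends to 48 at infinity, so it is a level one form of weight zero, hence the constant 48. The `U_2`
identity is the even part of `G2`, read off from the sum of the roots. -/

/-! ### Euler products -/

/-- Euler's product `∏ (1 - qⁿ)` over `n ≥ 1`. -/
noncomputable def eulerProduct (q : ℂ) : ℂ := ∏' n : ℕ, (1 - q ^ (n + 1))

/-- The product `∏ (1 - qⁿ)` over odd `n`. -/
noncomputable def oddEulerProduct (q : ℂ) : ℂ := ∏' n : ℕ, (1 - q ^ (2 * n + 1))

lemma norm_sq_lt_one {q : ℂ} (hq : ‖q‖ < 1) : ‖q ^ 2‖ < 1 := by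
  rw [norm_pow]; exact pow_lt_one₀ (norm_nonneg _) hq two_ne_zero

lemma one_sub_pow_succ_ne_zero {q : ℂ} (hq : ‖q‖ < 1) (n : ℕ) : 1 - q ^ (n + 1) ≠ 0 := by
  intro h
  have := pow_lt_one₀ (norm_nonneg q) hq n.succ_ne_zero
  rw [← norm_pow, ← sub_eq_zero.mp h, norm_one] at this
  exact lt_irrefl _ this

lemma summable_norm_pow_succ {q : ℂ} (hq : ‖q‖ < 1) : Summable fun n : ℕ ↦ ‖-q ^ (n + 1)‖ := by
  simpa using (summable_nat_add_iff 1).mpr (summable_geometric_of_lt_one (norm_nonneg _) hq)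

lemma eulerProduct_ne_zero {q : ℂ} (hq : ‖q‖ < 1) : eulerProduct q ≠ 0 := by
  simp_rw [eulerProduct, sub_eq_add_neg]
  refine tprod_one_add_ne_zero_of_summable (f := fun n : ℕ ↦ -q ^ (n + 1)) (fun n ↦ ?_)
    (summable_norm_pow_succ hq)
  simpa [← sub_eq_add_neg] using one_sub_pow_succ_ne_zero hq n

lemma eulerProduct_zero : eulerProduct 0 = 1 := by simp [eulerProduct]

lemma differentiableAt_eulerProduct {q : ℂ} (hq : ‖q‖ < 1) :
    DifferentiableAt ℂ eulerProduct q :=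
  ModularForm.differentiableOn_tprod_one_sub_pow.differentiableAt
    (isOpen_ball.mem_nhds (by simpa using hq))

/-- Logarithmic differentiation factor by factor: at 0 only the factor `1 - q` contributes. -/
lemma hasDerivAt_eulerProduct_zero : HasDerivAt eulerProduct (-1) 0 := by
  have hlog (n : ℕ) :
      logDeriv (fun q : ℂ ↦ 1 - q ^ (n + 1)) 0 = if n = 0 then -1 else 0 := by
    rcases eq_or_ne n 0 with rfl | hn
    · simp [logDeriv_apply]
    · simp [logDeriv_apply, hn]
  have key := logDeriv_tprod_eq_tsum (f := fun (n : ℕ) (q : ℂ) ↦ 1 - q ^ (n + 1)) isOpen_ball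
    (mem_ball_self one_pos) (by simp) (fun i ↦ by fun_prop)
    (by simpa only [hlog] using (hasSum_ite_eq 0 (-1 : ℂ)).summable)
    ModularForm.multipliableLocallyUniformlyOn_one_sub_pow (by simp)
  simp only [hlog, tsum_ite_eq] at key
  rw [logDeriv_apply] at key
  have h0 : (∏' n : ℕ, (1 - (0 : ℂ) ^ (n + 1))) = 1 := by simp
  rw [h0, div_one] at key
  exact key ▸ (differentiableAt_eulerProduct (by simp)).hasDerivAt

lemma multipliable_one_sub_pow_odd {q : ℂ} (hq : ‖q‖ < 1) :
    Multipliable fun n : ℕ ↦ 1 - q ^ (2 * n + 1) := by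
  simp_rw [sub_eq_add_neg]
  exact multipliable_one_add_of_summable ((summable_norm_pow_succ hq).comp_injective
    (mul_right_injective₀ (two_ne_zero (α := ℕ))))

lemma eulerProduct_eq_odd_mul {q : ℂ} (hq : ‖q‖ < 1) :
    eulerProduct q = oddEulerProduct q * eulerProduct (q ^ 2) := by
  have h2 : (fun n : ℕ ↦ 1 - q ^ (2 * n + 1 + 1)) = fun n ↦ 1 - (q ^ 2) ^ (n + 1) := by
    ext n; ring
  have := tprod_even_mul_odd (f := fun n : ℕ ↦ 1 - q ^ (n + 1)) (multipliable_one_sub_pow_odd hq)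
    (by simpa only [h2] using ModularForm.multipliable_one_sub_pow (norm_sq_lt_one hq))
  rw [h2] at this
  exact this.symm

lemma oddEulerProduct_mul_neg {q : ℂ} (hq : ‖q‖ < 1) :
    oddEulerProduct q * oddEulerProduct (-q) = oddEulerProduct (q ^ 2) := by
  rw [oddEulerProduct, oddEulerProduct, ← (multipliable_one_sub_pow_odd hq).tprod_mul
    (multipliable_one_sub_pow_odd (by simpa using hq))]
  refine tprod_congr fun n ↦ ?_
  rw [Odd.neg_pow ⟨n, rfl⟩]
  ring

lemma eulerProduct_mul_neg {q : ℂ} (hq : ‖q‖ < 1) :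
    eulerProduct q * eulerProduct (-q) * eulerProduct ((q ^ 2) ^ 2) = eulerProduct (q ^ 2) ^ 3 := by
  rw [eulerProduct_eq_odd_mul hq, eulerProduct_eq_odd_mul (q := -q) (by simpa using hq), neg_sq]
  linear_combination eulerProduct (q ^ 2) ^ 2 * eulerProduct ((q ^ 2) ^ 2) *
    oddEulerProduct_mul_neg hq - eulerProduct (q ^ 2) ^ 2 *
      eulerProduct_eq_odd_mul (norm_sq_lt_one hq)

lemma eta_eq_qParam_mul_eulerProduct (z : ℂ) :
    ModularForm.eta z = Periodic.qParam 24 z * eulerProduct (Periodic.qParam 1 z) := rfl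

lemma qParam_one_two_mul (z : ℂ) : Periodic.qParam 1 (2 * z) = Periodic.qParam 1 z ^ 2 := by
  simp only [Periodic.qParam, ← exp_nat_mul]
  congr 1; push_cast; ring

/-! ### Product formula for `G2` -/

/-- The power series `∏ (1 + qⁿ)²⁴`, as a quotient of Euler products. -/
noncomputable def eulerRatio (q : ℂ) : ℂ := (eulerProduct (q ^ 2) / eulerProduct q) ^ 24

lemma eulerRatio_ne_zero {q : ℂ} (hq : ‖q‖ < 1) : eulerRatio q ≠ 0 :=
  pow_ne_zero _ (div_ne_zero (eulerProduct_ne_zero (norm_sq_lt_one hq)) (eulerProduct_ne_zero hq))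

lemma eulerRatio_zero : eulerRatio 0 = 1 := by simp [eulerRatio, eulerProduct_zero]

lemma differentiableAt_eulerRatio {q : ℂ} (hq : ‖q‖ < 1) : DifferentiableAt ℂ eulerRatio q := by
  have h := (differentiableAt_eulerProduct (norm_sq_lt_one hq)).comp q
    (differentiableAt_pow 2 (x := q))
  exact (h.div (differentiableAt_eulerProduct hq) (eulerProduct_ne_zero hq)).pow 24

lemma hasDerivAt_eulerRatio_zero : HasDerivAt eulerRatio 24 0 := by
  have h : HasDerivAt (fun q : ℂ ↦ eulerProduct (q ^ 2)) 0 0 := by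
    have h1 : HasDerivAt eulerProduct (-1) ((0 : ℂ) ^ 2) := by
      simpa using hasDerivAt_eulerProduct_zero
    have h2 := h1.comp (0 : ℂ) (hasDerivAt_pow 2 (0 : ℂ))
    exact h2.congr_deriv (by simp)
  have h2 := (h.fun_div hasDerivAt_eulerProduct_zero (by simp [eulerProduct_zero])).fun_pow 24
  exact h2.congr_deriv (by norm_num [eulerProduct_zero])

lemma eulerRatio_mul_neg {q : ℂ} (hq : ‖q‖ < 1) :
    eulerRatio q * eulerRatio (-q) = eulerRatio (q ^ 2) := by
  have hq' : ‖-q‖ < 1 := by simpa using hq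
  have h1 := eulerProduct_ne_zero hq
  have h2 := eulerProduct_ne_zero hq'
  have h3 := eulerProduct_ne_zero (norm_sq_lt_one hq)
  rw [eulerRatio, eulerRatio, eulerRatio, ← mul_pow, neg_sq]
  congr 1
  rw [← mul_div_mul_comm, div_eq_div_iff (mul_ne_zero h1 h2) h3]
  linear_combination -eulerProduct_mul_neg hq

lemma eta_ratio_pow_eq (z : ℂ) :
    (ModularForm.eta (2 * z) / ModularForm.eta z) ^ 24 =
      Periodic.qParam 1 z * eulerRatio (Periodic.qParam 1 z) := by
  rw [eta_eq_qParam_mul_eulerProduct, eta_eq_qParam_mul_eulerProduct, mul_div_mul_comm, mul_pow,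
    qParam_one_two_mul, eulerRatio]
  congr 1
  -- The prefactors of eta leave `24 * (2z/24 - z/24) = z` in the exponent.
  simp only [Periodic.qParam, ← exp_sub, ← exp_nat_mul]
  congr 1; push_cast; ring

lemma G2_of_ne_zero {q : ℂ} (hq : ‖q‖ < 1) (hq0 : q ≠ 0) : G2 q = q * eulerRatio q := by
  have him := Periodic.im_invQParam_pos_of_norm_lt_one one_pos hq hq0
  rw [G2, UpperHalfPlane.cuspFunction, Periodic.cuspFunction_eq_of_nonzero 1 _ hq0, comp_apply,
    UpperHalfPlane.ofComplex_apply_of_im_pos him, g2, eta_ratio_pow_eq]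
  simp only [Periodic.qParam_right_inv one_ne_zero hq0]

lemma G2_zero : G2 0 = 0 := by
  rw [G2, UpperHalfPlane.cuspFunction, Periodic.cuspFunction_zero_eq_limUnder_nhds_ne]
  refine Tendsto.limUnder_eq (Tendsto.congr' (f₁ := fun q ↦ q * eulerRatio q) ?_ ?_)
  · filter_upwards [self_mem_nhdsWithin, nhdsWithin_le_nhds (ball_mem_nhds (0 : ℂ) one_pos)]
      with q hq0 hq
    exact (G2_of_ne_zero (by simpa using hq) hq0).symm
  · have : ContinuousAt (fun q ↦ q * eulerRatio q) 0 :=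
      continuousAt_id.mul (differentiableAt_eulerRatio (by simp)).continuousAt
    simpa using this.tendsto.mono_left nhdsWithin_le_nhds

/-- `G₂(q) = q ∏ (1 + qⁿ)²⁴` on the unit disc. -/
lemma G2_eq {q : ℂ} (hq : ‖q‖ < 1) : G2 q = q * eulerRatio q := by
  rcases eq_or_ne q 0 with rfl | hq0
  · simp [G2_zero]
  · exact G2_of_ne_zero hq hq0

lemma G2_ne_zero {q : ℂ} (hq : ‖q‖ < 1) (hq0 : q ≠ 0) : G2 q ≠ 0 := by
  rw [G2_eq hq]; exact mul_ne_zero hq0 (eulerRatio_ne_zero hq)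

lemma differentiableOn_G2 : DifferentiableOn ℂ G2 (ball 0 1) := by
  refine DifferentiableOn.congr (f := fun q ↦ q * eulerRatio q) (fun q hq ↦ ?_)
    fun q hq ↦ G2_eq (by simpa using hq)
  exact (differentiableAt_id.mul
    (differentiableAt_eulerRatio (by simpa using hq))).differentiableWithinAt

lemma hasSum_G2Series {q : ℂ} (hq : ‖q‖ < 1) :
    HasSum (fun n : ℕ ↦ PowerSeries.coeff n G2Series * q ^ n) (G2 q) := by
  convert! hasSum_taylorSeries_on_ball (r := 1) (c := 0) differentiableOn_G2
    (by simpa using hq) using 2 with n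
  rw [G2Series, UpperHalfPlane.qExpansion_coeff, sub_zero, smul_eq_mul, smul_eq_mul, ← G2]
  ring

lemma G2_mul_neg {q : ℂ} (hq : ‖q‖ < 1) : G2 q * G2 (-q) = -G2 (q ^ 2) := by
  rw [G2_eq hq, G2_eq (q := -q) (by simpa using hq), G2_eq (norm_sq_lt_one hq),
    ← eulerRatio_mul_neg hq]
  ring

lemma G2_qParam {z : ℂ} (hz : 0 < z.im) :
    G2 (Periodic.qParam 1 z) = (ModularForm.eta (2 * z) / ModularForm.eta z) ^ 24 := by
  rw [G2_eq (Periodic.norm_qParam_lt_one one_pos hz), eta_ratio_pow_eq]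

/-! ### A level one modular function that is constant -/

section LevelOne

open UpperHalfPlane hiding I
open scoped MatrixGroups Manifold

/-- This is the weight 12 invariance of the discriminant under `S`. -/
lemma eta_neg_one_div_pow {z : ℂ} (hz : 0 < z.im) :
    ModularForm.eta (-1 / z) ^ 24 = z ^ 12 * ModularForm.eta z ^ 24 := by
  have hz0 : z ≠ 0 := ne_zero (⟨z, hz⟩ : ℍ)
  have h := congrFun ModularForm.discriminant_S_invariant ⟨z, hz⟩
  rw [ModularForm.SL_slash_apply, modular_S_smul, ModularGroup.denom_S] at h
  simp only [ModularForm.discriminant, zpow_neg] at h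
  have h' : ModularForm.eta (-1 / z) ^ 24 * (z ^ 12)⁻¹ = ModularForm.eta z ^ 24 := by
    rw [neg_div, one_div, ← inv_neg]; exact_mod_cast h
  rw [← h']
  field_simp

/-- The Fricke involution `τ ↦ -1/(2τ)` inverts `g₂` up to the factor `2¹²`. -/
lemma G2_fricke {z : ℂ} (hz : 0 < z.im) :
    4096 * G2 (Periodic.qParam 1 (-1 / (2 * z))) * G2 (Periodic.qParam 1 z) = 1 := by
  have hz2 : 0 < (2 * z).im := by simpa using hz
  have hz' : 0 < (-1 / (2 * z)).im := by
    rw [neg_div, one_div, ← inv_neg]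
    exact im_inv_neg_coe_pos ⟨2 * z, hz2⟩
  have hz0 : z ≠ 0 := ne_zero (⟨z, hz⟩ : ℍ)
  have h1 := ModularForm.eta_ne_zero hz
  have h2 := ModularForm.eta_ne_zero hz2
  -- The two eta transformations contribute `z ^ 12 / (2 * z) ^ 12 = 1 / 4096`.
  rw [G2_qParam hz', G2_qParam hz, div_pow, div_pow, eta_neg_one_div_pow hz2,
    show 2 * (-1 / (2 * z)) = -1 / z by field_simp, eta_neg_one_div_pow hz]
  field_simp
  rw [mul_div_cancel_right₀ _ (by rwa [mul_comm])]
  norm_num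

/-- The weight zero level one modular function `𝔣²⁴ - 𝔣₁²⁴ - 𝔣₂²⁴` as a function of `e^{πiτ}`. -/
noncomputable def weberSum (s : ℂ) : ℂ :=
  G2 s / G2 (s ^ 2) - 1 / G2 s - 4096 * G2 (s ^ 2)

/-- Since `-1 / G2 s = G2 (-s) / G2 (s ^ 2)`, changing the sign of `s` swaps the first two terms. -/
lemma weberSum_neg {s : ℂ} (hs : ‖s‖ < 1) (hs0 : s ≠ 0) : weberSum (-s) = weberSum s := by
  have h1 := G2_ne_zero hs hs0
  have h2 := G2_ne_zero (norm_sq_lt_one hs) (pow_ne_zero 2 hs0)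
  have h3 : G2 (-s) = -G2 (s ^ 2) / G2 s := by
    rw [eq_div_iff h1, mul_comm, G2_mul_neg hs]
  rw [weberSum, weberSum, neg_sq, h3]
  field_simp
  ring

lemma differentiableAt_weberSum {s : ℂ} (hs : ‖s‖ < 1) (hs0 : s ≠ 0) :
    DifferentiableAt ℂ weberSum s := by
  have hd {q : ℂ} (hq : ‖q‖ < 1) : DifferentiableAt ℂ G2 q :=
    differentiableOn_G2.differentiableAt (isOpen_ball.mem_nhds (by simpa using hq))
  have h1 := hd hs
  have h2 : DifferentiableAt ℂ (fun s ↦ G2 (s ^ 2)) s :=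
    (hd (norm_sq_lt_one hs)).comp s (differentiableAt_pow 2 (x := s))
  have h3 := G2_ne_zero hs hs0
  have h4 := G2_ne_zero (norm_sq_lt_one hs) (pow_ne_zero 2 hs0)
  exact ((h1.div h2 h4).sub ((differentiableAt_const 1).div h1 h3)).sub (h2.const_mul 4096)

/-- With `u = eulerRatio`, the two polar terms combine to `(u(s)² - u(s²)) / (s u(s) u(s²))`, whose
limit is the derivative of the numerator at 0, namely `2 * 24 = 48`. -/
lemma tendsto_weberSum : Tendsto weberSum (𝓝[≠] 0) (𝓝 48) := by
  have hcont : ContinuousAt eulerRatio 0 := (differentiableAt_eulerRatio (by simp)).continuousAt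
  have hsq : Tendsto (fun s : ℂ ↦ s ^ 2) (𝓝 0) (𝓝 0) := by
    simpa using (continuous_pow 2 (M := ℂ)).tendsto 0
  have hu : Tendsto eulerRatio (𝓝 0) (𝓝 1) := by simpa [eulerRatio_zero] using hcont.tendsto
  have hnum : HasDerivAt (fun s ↦ eulerRatio s ^ 2 - eulerRatio (s ^ 2)) 48 0 := by
    have h1 : HasDerivAt eulerRatio 24 ((0 : ℂ) ^ 2) := by
      simpa using hasDerivAt_eulerRatio_zero
    have h2 := h1.comp (0 : ℂ) (hasDerivAt_pow 2 (0 : ℂ))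
    have h3 := (hasDerivAt_eulerRatio_zero.fun_pow 2).sub h2
    exact h3.congr_deriv (by norm_num [eulerRatio_zero])
  have hslope := hnum.tendsto_slope
  have hu2 := hu.comp hsq
  have hrest : Tendsto (fun s ↦ eulerRatio s * eulerRatio (s ^ 2)) (𝓝[≠] 0) (𝓝 1) := by
    simpa using (hu.mul hu2).mono_left nhdsWithin_le_nhds
  have hlast : Tendsto (fun s : ℂ ↦ 4096 * (s ^ 2 * eulerRatio (s ^ 2))) (𝓝[≠] 0) (𝓝 0) := by
    simpa using ((hsq.mul hu2).const_mul 4096).mono_left nhdsWithin_le_nhds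
  have := (hslope.div hrest one_ne_zero).sub hlast
  rw [div_one, sub_zero] at this
  refine this.congr' ?_
  filter_upwards [self_mem_nhdsWithin, nhdsWithin_le_nhds (ball_mem_nhds (0 : ℂ) one_pos)]
    with s (hs0 : s ≠ 0) hs
  have hs : ‖s‖ < 1 := by simpa using hs
  have h1 := eulerRatio_ne_zero hs
  have h2 := eulerRatio_ne_zero (norm_sq_lt_one hs)
  simp only [Pi.div_apply]
  rw [slope_def_field, weberSum, G2_eq hs, G2_eq (norm_sq_lt_one hs)]
  simp only [eulerRatio_zero, ne_eq, OfNat.ofNat_ne_zero, not_false_eq_true, zero_pow, one_pow,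
    sub_self, sub_zero]
  field_simp

/-- `weberSum` as a function on the upper half-plane. -/
noncomputable def weberFun (τ : ℍ) : ℂ := weberSum (Periodic.qParam 2 τ)

lemma norm_qParam_two_lt_one (τ : ℍ) : ‖Periodic.qParam 2 (τ : ℂ)‖ < 1 :=
  Periodic.norm_qParam_lt_one two_pos τ.im_pos

lemma qParam_two_eq (z : ℂ) : Periodic.qParam 2 z = Periodic.qParam 1 (z / 2) := by
  simp only [Periodic.qParam]
  congr 1; push_cast; ring

lemma qParam_two_sq (z : ℂ) : Periodic.qParam 2 z ^ 2 = Periodic.qParam 1 z := by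
  rw [qParam_two_eq, ← qParam_one_two_mul]
  congr 1; ring

lemma weberFun_slash_T : weberFun ∣[(0 : ℤ)] ModularGroup.T = weberFun := by
  ext τ
  rw [ModularForm.SL_slash_apply, modular_T_smul, neg_zero, zpow_zero, mul_one, weberFun, weberFun,
    -- Translation by 1 changes the sign of `e^{πiτ}`.
    ← weberSum_neg (norm_qParam_two_lt_one τ) (exp_ne_zero _)]
  congr 1
  rw [coe_vadd, Periodic.qParam, Periodic.qParam, neg_eq_neg_one_mul, ← exp_pi_mul_I, ← exp_add]
  congr 1; push_cast; ring

/-- The Fricke relation at `τ/2` and at `τ` fixes the quotient term and swaps the other two. -/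
lemma weberFun_slash_S : weberFun ∣[(0 : ℤ)] ModularGroup.S = weberFun := by
  ext τ
  rw [ModularForm.SL_slash_apply, modular_S_smul, neg_zero, zpow_zero, mul_one, weberFun, weberFun]
  have hz2 : 0 < ((τ : ℂ) / 2).im := by simpa using τ.im_pos
  have h1 := G2_fricke hz2
  have h2 := G2_fricke τ.im_pos
  have e1 : -1 / (2 * ((τ : ℂ) / 2)) = (-(τ : ℂ))⁻¹ := by
    rw [mul_div_cancel₀ _ two_ne_zero, neg_div, one_div, inv_neg]
  have e2 : -1 / (2 * (τ : ℂ)) = (-(τ : ℂ))⁻¹ / 2 := by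
    have := τ.ne_zero
    field_simp
  rw [e1, ← qParam_two_eq] at h1
  rw [e2, ← qParam_two_eq] at h2
  simp only [weberSum, qParam_two_sq]
  have n1 := right_ne_zero_of_mul_eq_one h1
  have n2 := right_ne_zero_of_mul_eq_one h2
  have h1' : G2 (Periodic.qParam 1 (-(τ : ℂ))⁻¹) = 1 / (4096 * G2 (Periodic.qParam 2 τ)) := by
    rw [eq_div_iff (by simpa using n1), ← h1]; ring
  have h2' : G2 (Periodic.qParam 2 (-(τ : ℂ))⁻¹) = 1 / (4096 * G2 (Periodic.qParam 1 τ)) := by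
    rw [eq_div_iff (by simpa using n2), ← h2]; ring
  rw [h1', h2']
  field_simp
  ring

lemma mdifferentiable_weberFun : MDiff weberFun := by
  rw [UpperHalfPlane.mdifferentiable_iff]
  refine .congr (f := fun z ↦ weberSum (Periodic.qParam 2 z)) (fun z hz ↦ ?_) fun z hz ↦ ?_
  · exact ((differentiableAt_weberSum (norm_qParam_two_lt_one ⟨z, hz⟩) (exp_ne_zero _)).comp z
      (Periodic.differentiable_qParam z)).differentiableWithinAt
  · simp [weberFun, ofComplex_apply_of_im_pos hz]

lemma tendsto_weberFun : Tendsto weberFun atImInfty (𝓝 48) :=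
  tendsto_weberSum.comp ((Periodic.qParam_tendsto two_pos).comp tendsto_coe_atImInfty)

/-- `weberFun` as a modular form of weight zero and level one. -/
noncomputable def weberForm : ModularForm 𝒮ℒ 0 where
  toFun := weberFun
  slash_action_eq' A hA := by
    obtain ⟨A, rfl⟩ := hA
    exact SlashInvariantForm.slash_action_generators_SL2Z weberFun_slash_S weberFun_slash_T A
  holo' := mdifferentiable_weberFun
  bdd_at_cusps' hc := by
    rw [Subgroup.IsArithmetic.isCusp_iff_isCusp_SL2Z] at hc
    rw [OnePoint.isBoundedAt_iff_forall_SL2Z hc]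
    intro γ _
    rw [SlashInvariantForm.slash_action_generators_SL2Z weberFun_slash_S weberFun_slash_T]
    exact tendsto_weberFun.isBigO_one ℝ

lemma weberFun_eq (τ : ℍ) : weberFun τ = 48 := by
  obtain ⟨c, hc⟩ := ModularFormClass.levelOne_weight_zero_const weberForm
  have hc' : weberFun = Function.const ℍ c := hc
  have h := tendsto_weberFun
  rw [hc'] at h ⊢
  exact tendsto_nhds_unique tendsto_const_nhds h

lemma weberSum_eq {s : ℂ} (hs : ‖s‖ < 1) (hs0 : s ≠ 0) : weberSum s = 48 := by
  have h := weberFun_eq ⟨_, Periodic.im_invQParam_pos_of_norm_lt_one two_pos hs hs0⟩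
  rwa [weberFun, coe_mk, Periodic.qParam_right_inv two_ne_zero hs0] at h

end LevelOne

/-! ### Quadratic relation and sum of its roots -/

lemma G2_sq {q : ℂ} (hq : ‖q‖ < 1) :
    G2 q ^ 2 = G2 (q ^ 2) + G2 q * (48 * G2 (q ^ 2) + 4096 * G2 (q ^ 2) ^ 2) := by
  rcases eq_or_ne q 0 with rfl | hq0
  · simp [G2_zero]
  · have h := weberSum_eq hq hq0
    have h1 := G2_ne_zero hq hq0
    have h2 := G2_ne_zero (norm_sq_lt_one hq) (pow_ne_zero 2 hq0)
    rw [weberSum] at h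
    field_simp at h
    linear_combination h

lemma G2_add_neg {q : ℂ} (hq : ‖q‖ < 1) :
    G2 q + G2 (-q) = 48 * G2 (q ^ 2) + 4096 * G2 (q ^ 2) ^ 2 := by
  rcases eq_or_ne q 0 with rfl | hq0
  · simp [G2_zero]
  · apply mul_left_cancel₀ (G2_ne_zero hq hq0)
    linear_combination G2_sq hq + G2_mul_neg hq

/-! ### Power series and `U_2` -/

lemma hasFPowerSeriesOnBall_of_hasSum {f : ℂ → ℂ} {c : ℕ → ℂ}
    (h : ∀ q : ℂ, ‖q‖ < 1 → HasSum (fun n ↦ c n * q ^ n) (f q)) :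
    HasFPowerSeriesOnBall f (.ofScalars ℂ c) 0 1 where
  r_le := by
    refine le_of_forall_lt_imp_le_of_dense fun r hr ↦ ?_
    lift r to NNReal using hr.ne_top
    apply FormalMultilinearSeries.le_radius_of_summable
    have := (h (r : ℝ) (by simpa using hr)).summable.norm
    simpa [mul_comm] using this
  r_pos := one_pos
  hasSum {y} hy := by
    rw [← ENNReal.coe_one, eball_coe, NNReal.coe_one, mem_ball_zero_iff] at hy
    simpa [mul_comm] using h y hy

/-- A function on the unit disc has at most one power series expansion. -/
lemma PowerSeries.eq_of_hasSum {f : ℂ → ℂ} {a b : PowerSeries ℂ}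
    (ha : ∀ q : ℂ, ‖q‖ < 1 → HasSum (fun n ↦ coeff n a * q ^ n) (f q))
    (hb : ∀ q : ℂ, ‖q‖ < 1 → HasSum (fun n ↦ coeff n b * q ^ n) (f q)) : a = b := by
  have h := (hasFPowerSeriesOnBall_of_hasSum ha).hasFPowerSeriesAt.eq_formalMultilinearSeries
    (hasFPowerSeriesOnBall_of_hasSum hb).hasFPowerSeriesAt
  ext n
  exact congrFun (FormalMultilinearSeries.ofScalars_series_injective ℂ ℂ h) n

lemma PowerSeries.hasSum_mul {a b : PowerSeries ℂ} {q x y : ℂ}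
    (ha : HasSum (fun n ↦ coeff n a * q ^ n) x) (hb : HasSum (fun n ↦ coeff n b * q ^ n) y) :
    HasSum (fun n ↦ coeff n (a * b) * q ^ n) (x * y) := by
  have hprod (n : ℕ) : coeff n (a * b) * q ^ n = ∑ kl ∈ Finset.HasAntidiagonal.antidiagonal n,
      coeff kl.1 a * q ^ kl.1 * (coeff kl.2 b * q ^ kl.2) := by
    rw [coeff_mul, Finset.sum_mul]
    refine Finset.sum_congr rfl fun kl hkl ↦ ?_
    rw [← Finset.HasAntidiagonal.mem_antidiagonal.mp hkl]
    ring
  simp_rw [hprod]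
  rw [← ha.tsum_eq, ← hb.tsum_eq, tsum_mul_tsum_eq_tsum_sum_antidiagonal_of_summable_norm
    ha.summable.norm hb.summable.norm]
  exact (summable_norm_sum_mul_antidiagonal_of_summable_norm
    ha.summable.norm hb.summable.norm).of_norm.hasSum

lemma hasSum_atkinU_two {f : ℂ → ℂ} {a : PowerSeries ℂ} {q : ℂ}
    (h1 : HasSum (fun n ↦ PowerSeries.coeff n a * q ^ n) (f q))
    (h2 : HasSum (fun n ↦ PowerSeries.coeff n a * (-q) ^ n) (f (-q))) :
    HasSum (fun n ↦ PowerSeries.coeff n (atkinU 2 a) * (q ^ 2) ^ n) ((f q + f (-q)) / 2) := by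
  have h := (h1.add h2).div_const 2
  -- Averaging over `q` and `-q` kills the odd terms, so the sum may be reindexed by the even ones.
  rw [← (mul_right_injective₀ (two_ne_zero (α := ℕ))).hasSum_iff] at h
  · convert! h using 2 with n
    simp only [atkinU, PowerSeries.coeff_mk, comp_apply, (even_two_mul n).neg_pow, pow_mul]
    ring
  · intro n hn
    have hodd : Odd n := by
      rw [← Nat.not_even_iff_odd]
      rintro ⟨k, rfl⟩
      exact hn ⟨k, two_mul k⟩
    rw [hodd.neg_pow]
    ring

lemma atkinU_two_G2Series : atkinU 2 G2Series = 24 * G2Series + 2048 * G2Series ^ 2 := by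
  refine PowerSeries.eq_of_hasSum (f := fun q ↦ 24 * G2 q + 2048 * G2 q ^ 2) (fun w hw ↦ ?_)
    fun q hq ↦ ?_
  -- The sum `G2 q + G2 (-q)` yields a function of `q ^ 2`, so a square root of `w` is needed.
  · obtain ⟨q, rfl⟩ : ∃ q : ℂ, w = q ^ 2 := ⟨_, (cpow_nat_inv_pow w two_ne_zero).symm⟩
    have hq : ‖q‖ < 1 := by
      rw [norm_pow] at hw
      exact (pow_lt_one_iff_of_nonneg (norm_nonneg _) two_ne_zero).mp hw
    convert! hasSum_atkinU_two (f := G2) (hasSum_G2Series hq)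
      (hasSum_G2Series (q := -q) (by simpa using hq)) using 1
    rw [G2_add_neg hq]
    ring
  · have h := hasSum_G2Series hq
    convert! (h.mul_left 24).add ((PowerSeries.hasSum_mul h h).mul_left 2048) using 2 with n
    · rw [← map_ofNat (PowerSeries.C (R := ℂ)) 24, ← map_ofNat (PowerSeries.C (R := ℂ)) 2048,
        map_add, PowerSeries.coeff_C_mul, PowerSeries.coeff_C_mul, sq]
      ring
    · ring

theorem mainTheorem7 :
    (∀ τ : ℍ, G2 (Complex.exp (2 * Real.pi * Complex.I * (τ : ℂ))) = g2 τ) ∧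
    (∀ q : ℂ, ‖q‖ < 1 → HasSum (fun n : ℕ => PowerSeries.coeff n G2Series * q ^ n) (G2 q)) ∧
    (∀ q : ℂ, ‖q‖ < 1 →
      G2 q ^ 2 = G2 (q ^ 2) + G2 q * (48 * G2 (q ^ 2) + 4096 * G2 (q ^ 2) ^ 2)) ∧
    atkinU 2 G2Series = 24 * G2Series + 2048 * G2Series ^ 2 := by
  refine ⟨fun τ ↦ ?_, fun q ↦ hasSum_G2Series, fun q ↦ G2_sq, atkinU_two_G2Series⟩
  rw [g2, ← G2_qParam τ.im_pos, Periodic.qParam, ofReal_one, div_one]
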